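/- Let $\mathbf P=\{p_0,p_1,\dots\}$ be a countably infinite set of propositional letters. The formulas of modal iterative substitution logic (MISL) are given by $$\varphi ::= p \mid \neg\varphi \mid \varphi\wedge\varphi \mid \Diamond\varphi \mid \langle p:=\varphi\rangle\varphi \mid \langle (p:=\varphi)^*\rangle\varphi \qquad (p\in\mathbf P).$$ They are evaluated at states $w$ of Kripke models $M=(W,R,V)$ with $W\neq\emptyset$, one relation $R\subseteq W\times W$, and $V:\mathbf P\to 2^W$. The clauses for letters, $\neg$, $\wedge$ and $\Diamond$ are the usual ones. Moreover, $M,w\vDash\langle p:=\psi\rangle\varphi$ iff $M|_{p:=\psi},w\vDash\varphi$, where $M|_{p:=\psi}$ differs from $M$ only in that the truth set of $p$ is $\{v\in W: M,v\vDash\psi\}$; and $M,w\vDash\langle(p:=\psi)^*\rangle\varphi$ iff there is $n\in\mathbb N$ such that $\varphi$ is true at $w$ in the model obtained from $M$ by applying $N\mapsto N|_{p:=\psi}$ exactly $n$ times. A finite tree model is a model with finite $W$ and acyclic $R$ that has a root $r$ from which every state is reachable along $R$, such that every state other than $r$ has exactly one $R$-predecessor. A formula is satisfiable in a finite tree model if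 it is true at some state of some finite tree model. An instance $(U,V)$ of the Post correspondence problem (PCP) over $\Sigma=\{a,b\}$ consists of $U=(u_1,\dots,u_m)$ and $V=(v_1,\dots,v_m)$ in $(\Sigma^*)^m$, $m\in\mathbb N$, such that the pairs $(u_1,v_1),\dots,(u_m,v_m)$ are distinct. A solution is a sequence $i_1,\dots,i_l\in\{1,\dots,m\}$ with $l\ge 1$ and $u_{i_1}\cdots u_{i_l}=v_{i_1}\cdots v_{i_l}$. **Theorem.** There is a computable function that maps every instance $(U,V)$ of the PCP over $\{a,b\}$ to an MISL-formula $\varphi(U,V)$ such that $$\varphi(U,V)\text{ is satisfiable in a finite tree model}\iff (U,V)\text{ has a solution}.$$ Moreover, the problem whether a given MISL-formula is satisfiable in a finite tree model is undecidable. -/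

import Mathlib

namespace MISL

/-- Formulas of modal iterative substitution logic. The countable set of propositional letters
is `ℕ`. `sub p ψ φ` is `⟨p := ψ⟩ φ` and `iter p ψ φ` is `⟨(p := ψ)^*⟩ φ`. -/
inductive Formula : Type
  | var (p : ℕ) : Formula
  | neg (φ : Formula) : Formula
  | and (φ₁ φ₂ : Formula) : Formula
  | dia (φ : Formula) : Formula
  | sub (p : ℕ) (ψ φ : Formula) : Formula
  | iter (p : ℕ) (ψ φ : Formula) : Formula

/-- A Kripke model with set of states `W`: one accessibility relation and a valuation.
(Every use below comes with a point of `W`, so `W` is non-empty.) -/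
structure Model (W : Type) where
  R : W → W → Prop
  V : ℕ → Set W

namespace Model

/-- The model that differs from `M` only in that the truth set of `p` is `S`. -/
def assign {W : Type} (M : Model W) (p : ℕ) (S : Set W) : Model W :=
  { M with V := Function.update M.V p S }

/-- Truth of a formula at a state. In the clause for `iter p ψ φ`, the `n`-th iterate of
`N ↦ N|_{p := ψ}` started at `M` is the model `M|_{(p := ψ)^n}`. -/
def Sat {W : Type} : Formula → Model W → W → Prop
  | .var p, M, w => w ∈ M.V p
  | .neg φ, M, w => ¬ Sat φ M w
  | .and φ₁ φ₂, M, w => Sat φ₁ M w ∧ Sat φ₂ M w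
  | .dia φ, M, w => ∃ v, M.R w v ∧ Sat φ M v
  | .sub p ψ φ, M, w => Sat φ (M.assign p {v | Sat ψ M v}) w
  | .iter p ψ φ, M, w =>
      ∃ n : ℕ, Sat φ ((fun N : Model W => N.assign p {v | Sat ψ N v})^[n] M) w

/-- `M` is a finite tree model: finitely many states, and a root from which every state is
reachable; the states other than the root have exactly one predecessor, and there are no cycles
(so that the root has no predecessor). -/
def IsFiniteTree {W : Type} (M : Model W) : Prop :=
  Finite W ∧
  (∃ r : W, (∀ w, Relation.ReflTransGen M.R r w) ∧ ∀ w, w ≠ r → ∃! v, M.R v w) ∧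
  ∀ w, ¬ Relation.TransGen M.R w w

end Model

/-- `φ` is true at some state of some finite tree model. -/
def FiniteTreeSatisfiable (φ : Formula) : Prop :=
  ∃ (W : Type) (M : Model W) (w : W), M.IsFiniteTree ∧ Model.Sat φ M w

namespace Formula

/-- A bijective numbering of formulas: the remainder modulo `6` names the main connective. -/
def toNat : Formula → ℕ
  | var p => 6 * p
  | neg φ => 6 * toNat φ + 1
  | and φ₁ φ₂ => 6 * Nat.pair (toNat φ₁) (toNat φ₂) + 2
  | dia φ => 6 * toNat φ + 3
  | sub p ψ φ => 6 * Nat.pair p (Nat.pair (toNat ψ) (toNat φ)) + 4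
  | iter p ψ φ => 6 * Nat.pair p (Nat.pair (toNat ψ) (toNat φ)) + 5

/-- The inverse of `Formula.toNat`. -/
def ofNat (n : ℕ) : Formula :=
  if h : n % 6 = 0 then var (n / 6)
  else
    have h0 : n / 6 < n := by omega
    have h1 : (n / 6).unpair.1 < n := lt_of_le_of_lt (Nat.unpair_left_le _) h0
    have h2 : (n / 6).unpair.2 < n := lt_of_le_of_lt (Nat.unpair_right_le _) h0
    have h3 : (n / 6).unpair.2.unpair.1 < n := lt_of_le_of_lt (Nat.unpair_left_le _) h2
    have h4 : (n / 6).unpair.2.unpair.2 < n := lt_of_le_of_lt (Nat.unpair_right_le _) h2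
    if n % 6 = 1 then neg (ofNat (n / 6))
    else if n % 6 = 2 then and (ofNat (n / 6).unpair.1) (ofNat (n / 6).unpair.2)
    else if n % 6 = 3 then dia (ofNat (n / 6))
    else if n % 6 = 4 then
      sub (n / 6).unpair.1 (ofNat (n / 6).unpair.2.unpair.1) (ofNat (n / 6).unpair.2.unpair.2)
    else
      iter (n / 6).unpair.1 (ofNat (n / 6).unpair.2.unpair.1) (ofNat (n / 6).unpair.2.unpair.2)
termination_by n

theorem ofNat_toNat (φ : Formula) : ofNat (toNat φ) = φ := by
  have d (k r : ℕ) (h : r < 6) : (6 * k + r) / 6 = k := by omega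
  have m (k r : ℕ) (h : r < 6) : (6 * k + r) % 6 = r := by omega
  induction φ with
  | var p => rw [toNat, ofNat]; simp
  | neg φ ih => rw [toNat, ofNat]; simp [d, m, ih]
  | and φ₁ φ₂ ih₁ ih₂ => rw [toNat, ofNat]; simp [d, m, ih₁, ih₂]
  | dia φ ih => rw [toNat, ofNat]; simp [d, m, ih]
  | sub p ψ φ ih₁ ih₂ => rw [toNat, ofNat]; simp [d, m, ih₁, ih₂]
  | iter p ψ φ ih₁ ih₂ => rw [toNat, ofNat]; simp [d, m, ih₁, ih₂]

theorem toNat_ofNat (n : ℕ) : toNat (ofNat n) = n := by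
  induction n using Nat.strong_induction_on with
  | _ n ih =>
    rw [ofNat]
    split_ifs with h h1 h2 h3 h4
    · rw [toNat]; omega
    all_goals
      have h0 : n / 6 < n := by omega
      have k1 : (n / 6).unpair.1 < n := lt_of_le_of_lt (Nat.unpair_left_le _) h0
      have k2 : (n / 6).unpair.2 < n := lt_of_le_of_lt (Nat.unpair_right_le _) h0
      have k3 : (n / 6).unpair.2.unpair.1 < n := lt_of_le_of_lt (Nat.unpair_left_le _) k2
      have k4 : (n / 6).unpair.2.unpair.2 < n := lt_of_le_of_lt (Nat.unpair_right_le _) k2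
      simp only [toNat, ih _ h0, ih _ k1, ih _ k2, ih _ k3, ih _ k4, Nat.pair_unpair]
      omega

/-- Computability of functions to formulas and of sets of formulas refers to this numbering. -/
instance instDenumerable : Denumerable Formula :=
  Denumerable.mk' ⟨toNat, ofNat, ofNat_toNat, toNat_ofNat⟩

end Formula

/-- Words over a two-letter alphabet `{a, b}`; the letters are the two elements of `Bool`. -/
abbrev Word : Type := List Bool

/-- The list `[(u₁, v₁), …, (uₘ, vₘ)]` is an instance `(U, V)` of the Post correspondence problem:
its pairs are distinct. -/
def IsPCPInstance (I : List (Word × Word)) : Prop := I.Nodup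

/-- A solution: a sequence of indices `i₁, …, iₗ` with `l ≥ 1` and
`u_{i₁} ⋯ u_{iₗ} = v_{i₁} ⋯ v_{iₗ}`. -/
def HasPCPSolution (I : List (Word × Word)) : Prop :=
  ∃ s : List (Fin I.length), s ≠ [] ∧
    (s.map fun i => (I.get i).1).flatten = (s.map fun i => (I.get i).2).flatten

end MISL

/-! Satisfiability in finite trees can express every condition `∃ k, Q a k` with `Q` primitive
recursive: a formula checks `Q`, and the choice of the model supplies `k`. For the PCP, `k` codes a
sequence of pairs; for the halting problem, it bounds a computation.

Numbers are heights of marked chains below a state, called registers. A formula without iteration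
sees only bounded depth, but iterating `0 := ◇0` from `⊤` makes the letter `0` run through the
properties "there is a path of length n". Quantifying over the iterates compares heights
(`sat_scan`), so registers of a state can be equated with each other and with those of marked
successors. A tree can thus record a computation. Composition hands the arguments to subtrees;
primitive recursion is iteration of `0 := ψ` from `∅`, where each stage unwinds one recursion step
(`sat_lfp`). Only the letter `0` is ever reassigned, and every scan and every fixed point resets it
first, so nested uses do not interfere. Induction over `Nat.Primrec'` then yields a formula for each
primitive recursive function (`exists_computes`).

Witnesses are built inside one model whose states are all finite labelled trees. Equal subtrees are
shared there, so it is not itself a tree; unravelling from a state gives a finite tree model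
(`finiteTreeSatisfiable_of_sat`). Both claims follow from
`exists_computable_finiteTreeSatisfiable_iff`. -/

namespace MISL

namespace Formula

/-- A contradiction. -/
def bot : Formula := and (var 0) (neg (var 0))

/-- A tautology. -/
def top : Formula := neg bot

/-- Disjunction. -/
def or (φ ψ : Formula) : Formula := neg (and (neg φ) (neg ψ))

/-- Implication. -/
def imp (φ ψ : Formula) : Formula := neg (and φ (neg ψ))

/-- Equivalence. -/
def iff (φ ψ : Formula) : Formula := and (imp φ ψ) (imp ψ φ)

/-- Truth at all successors. -/
def box (φ : Formula) : Formula := neg (dia (neg φ))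

/-- Conjunction of a list of formulas. -/
def conj : List Formula → Formula
  | [] => top
  | φ :: l => and φ (conj l)

end Formula

/-! ### Registers: numbers as heights of marked chains -/

open Formula

/-- The letter marking the successors that start a chain holding the value of register `i`. -/
def reg (i : ℕ) : ℕ := 2 * i + 1

/-- The letter marking the successors that carry the `j`-th subcomputation. -/
def lnk (j : ℕ) : ℕ := 2 * j + 2

/-- There is an `R`-path of length `n` from `w`. -/
def HasPath {W : Type} (R : W → W → Prop) : ℕ → W → Prop
  | 0, _ => True
  | n + 1, w => ∃ v, R w v ∧ HasPath R n v

/-- The paths from each given state have bounded length. -/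
def PathFinite {W : Type} (R : W → W → Prop) : Prop := ∀ w, {n | HasPath R n w}.Finite

namespace Model

variable {W : Type}

/-- The value of register `i` at `w` exceeds `n`. -/
def Exceeds (M : Model W) (w : W) (i n : ℕ) : Prop :=
  ∃ v, M.R w v ∧ v ∈ M.V (reg i) ∧ HasPath M.R n v

/-- The value of register `i` at `w`: the maximal number of states on a path that starts at a
successor of `w` marked with `reg i`. -/
noncomputable def val (M : Model W) (w : W) (i : ℕ) : ℕ := {n | M.Exceeds w i n}.ncard

@[simp] theorem assign_R (M : Model W) (p : ℕ) (S : Set W) : (M.assign p S).R = M.R := rfl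

@[simp] theorem assign_V_self (M : Model W) (p : ℕ) (S : Set W) : (M.assign p S).V p = S := by
  simp [assign]

@[simp] theorem assign_V_reg (M : Model W) (i : ℕ) (S : Set W) :
    (M.assign 0 S).V (reg i) = M.V (reg i) := by
  simp [assign, reg]

@[simp] theorem assign_V_lnk (M : Model W) (i : ℕ) (S : Set W) :
    (M.assign 0 S).V (lnk i) = M.V (lnk i) := by
  simp [assign, lnk]

@[simp] theorem assign_assign (M : Model W) (p : ℕ) (S T : Set W) :
    (M.assign p S).assign p T = M.assign p T := by
  simp [assign]

@[simp] theorem exceeds_assign (M : Model W) (S : Set W) (w : W) (i n : ℕ) :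
    (M.assign 0 S).Exceeds w i n ↔ M.Exceeds w i n := by
  simp [Exceeds]

@[simp] theorem val_assign (M : Model W) (S : Set W) (w : W) (i : ℕ) :
    (M.assign 0 S).val w i = M.val w i := by
  simp [val]

end Model

theorem HasPath.mono {W : Type} {R : W → W → Prop} {m n : ℕ} (h : m ≤ n) {w : W}
    (hw : HasPath R n w) : HasPath R m w := by
  induction m generalizing n w with
  | zero => trivial
  | succ m ih =>
    obtain ⟨n, rfl⟩ : ∃ k, n = k + 1 := ⟨n - 1, by omega⟩
    obtain ⟨v, hv, hp⟩ := hw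
    exact ⟨v, hv, ih (by omega) hp⟩

/-- Well-founded induction: a non-empty path from `w` is a step to one of finitely many successors
followed by a path from there. -/
theorem PathFinite.of_wellFounded {W : Type} {R : W → W → Prop} (hwf : WellFounded (flip R))
    (hfin : ∀ w, {v | R w v}.Finite) : PathFinite R := by
  intro w
  induction w using hwf.induction with
  | _ w ih =>
    refine (((hfin w).biUnion fun v hv => (ih v hv).image Nat.succ).insert 0).subset ?_
    rintro (_ | n) hn
    · simp
    · obtain ⟨v, hv, hp⟩ := hn
      exact Or.inr (Set.mem_biUnion hv ⟨n, hp, rfl⟩)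

namespace Model

variable {W : Type}

/-- Truncating paths shows that the exceeded numbers form an initial segment of `ℕ`, finite by
path-finiteness; its cardinality is therefore its least non-member. -/
theorem exceeds_iff {M : Model W} (hM : PathFinite M.R) (w : W) (i n : ℕ) :
    M.Exceeds w i n ↔ n < M.val w i := by
  have hfin : {n | M.Exceeds w i n}.Finite := by
    refine ((hM w).preimage Nat.succ_injective.injOn).subset ?_
    rintro n ⟨v, hv, -, hp⟩
    exact ⟨v, hv, hp⟩
  have hlow : ∀ m n, m ≤ n → M.Exceeds w i n → M.Exceeds w i m := by
    rintro m n hmn ⟨v, hv, hl, hp⟩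
    exact ⟨v, hv, hl, hp.mono hmn⟩
  constructor
  · intro h
    have : (Set.Iic n).ncard ≤ M.val w i :=
      Set.ncard_le_ncard (fun m hm => hlow m n hm h) hfin
    rw [Set.ncard_eq_toFinset_card'] at this
    simp at this
    omega
  · intro h
    by_contra hn
    have : M.val w i ≤ (Set.Iio n).ncard := by
      refine Set.ncard_le_ncard (fun m hm => ?_) (Set.finite_Iio n)
      by_contra hmn
      exact hn (hlow n m (not_lt.1 hmn) hm)
    rw [Set.ncard_eq_toFinset_card'] at this
    simp at this
    omega

theorem val_eq_of_forall {M : Model W} (hM : PathFinite M.R) {w : W} {i m : ℕ}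
    (h : ∀ n, M.Exceeds w i n ↔ n < m) : M.val w i = m := by
  have h₁ := (exceeds_iff hM w i m).not.1 (by simp [h])
  have h₂ := (exceeds_iff hM w i (M.val w i)).not.2 (lt_irrefl _)
  rw [h] at h₂
  omega

end Model

namespace Formula

/-- `χ` is true whatever the length `n`, where the letter `0` means that there is a path of
length `n`. -/
def scan (χ : Formula) : Formula := sub 0 top (neg (iter 0 (dia (var 0)) (neg χ)))

/-- Some successor marked with `reg i` satisfies `χ`. -/
def diaReg (i : ℕ) (χ : Formula) : Formula := dia (and (var (reg i)) χ)

/-- Registers `i` and `j` have the same value. -/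
def sameReg (i j : ℕ) : Formula := scan (iff (diaReg i (var 0)) (diaReg j (var 0)))

/-- The value of register `i` is the successor of the value of register `j`. -/
def succReg (i j : ℕ) : Formula :=
  and (diaReg i top) (scan (iff (diaReg i (dia (var 0))) (diaReg j (var 0))))

/-- Register `i` agrees with register `k` of all successors marked with `lnk c`. -/
def linkReg (c i k : ℕ) : Formula :=
  scan (and (imp (diaReg i (var 0)) (box (imp (var (lnk c)) (diaReg k (var 0)))))
    (imp (dia (and (var (lnk c)) (diaReg k (var 0)))) (diaReg i (var 0))))

/-- Some successor marked with `lnk c` satisfies `φ`, and its registers `k < K` agree with the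
registers `s k`. -/
def link (c : ℕ) (s : ℕ → ℕ) (K : ℕ) (φ : Formula) : Formula :=
  and (dia (and (var (lnk c)) φ)) (conj ((List.range K).map fun k => linkReg c (s k) k))

/-- Least fixed point of `ψ` in the letter `0`, by iteration from the empty set. -/
def lfp (ψ : Formula) : Formula := sub 0 bot (iter 0 ψ (var 0))

end Formula

/-! ### Truth conditions of the register formulas -/

section Sat

variable {W : Type} (M : Model W) (w : W)

open Model

@[simp] theorem sat_var (p : ℕ) : Sat (var p) M w ↔ w ∈ M.V p := Iff.rfl

@[simp] theorem sat_neg (φ : Formula) : Sat (neg φ) M w ↔ ¬ Sat φ M w := Iff.rfl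

@[simp] theorem sat_and (φ ψ : Formula) : Sat (and φ ψ) M w ↔ Sat φ M w ∧ Sat ψ M w := Iff.rfl

@[simp] theorem sat_dia (φ : Formula) : Sat (dia φ) M w ↔ ∃ v, M.R w v ∧ Sat φ M v := Iff.rfl

@[simp] theorem sat_bot : ¬ Sat bot M w := fun h => h.2 h.1

@[simp] theorem sat_top : Sat top M w := sat_bot M w

@[simp] theorem sat_or (φ ψ : Formula) : Sat (or φ ψ) M w ↔ Sat φ M w ∨ Sat ψ M w := by
  simp [Formula.or]; tauto

@[simp] theorem sat_imp (φ ψ : Formula) : Sat (imp φ ψ) M w ↔ (Sat φ M w → Sat ψ M w) := by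
  simp [imp]

@[simp] theorem sat_iff (φ ψ : Formula) : Sat (iff φ ψ) M w ↔ (Sat φ M w ↔ Sat ψ M w) := by
  simp [Formula.iff]; tauto

@[simp] theorem sat_box (φ : Formula) : Sat (box φ) M w ↔ ∀ v, M.R w v → Sat φ M v := by
  simp [box]

@[simp] theorem sat_conj (l : List Formula) : Sat (conj l) M w ↔ ∀ φ ∈ l, Sat φ M w := by
  induction l with
  | nil => simp [conj]
  | cons φ l ih => simp [conj, ih]

@[simp] theorem sat_diaReg (i : ℕ) (χ : Formula) :
    Sat (diaReg i χ) M w ↔ ∃ v, M.R w v ∧ v ∈ M.V (reg i) ∧ Sat χ M v := by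
  simp [diaReg]

/-- The iterates of `0 := ◇0` started at `⊤` are exactly the truth sets of "there is a path of
length `n`". The two negations around `iter` turn its existential quantifier over `n` into a
universal one. -/
theorem sat_scan (χ : Formula) :
    Sat (scan χ) M w ↔ ∀ n, Sat χ (M.assign 0 {v | HasPath M.R n v}) w := by
  have key : ∀ n, (fun N : Model W => N.assign 0 {v | Sat (dia (var 0)) N v})^[n]
      (M.assign 0 {v | Sat top M v}) = M.assign 0 {v | HasPath M.R n v} := by
    intro n
    induction n with
    | zero => simp [HasPath]
    | succ n ih =>
      rw [Function.iterate_succ_apply', ih]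
      simp [HasPath]
  simp only [scan, Sat, not_exists, not_not]
  simp only [Sat] at key
  exact forall_congr' fun n => by rw [key]

theorem sat_lfp (ψ : Formula) :
    Sat (lfp ψ) M w ↔
      ∃ n, w ∈ (fun X : Set W => {v | Sat ψ (M.assign 0 X) v})^[n] ∅ := by
  have key : ∀ n, (fun N : Model W => N.assign 0 {v | Sat ψ N v})^[n]
      (M.assign 0 {v | Sat bot M v}) =
        M.assign 0 ((fun X : Set W => {v | Sat ψ (M.assign 0 X) v})^[n] ∅) := by
    intro n
    induction n with
    | zero => simp
    | succ n ih =>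
      rw [Function.iterate_succ_apply', Function.iterate_succ_apply', ih]
      simp
  simp only [lfp, Sat]
  exact exists_congr fun n => by rw [key, assign_V_self]

theorem sat_sameReg (hM : PathFinite M.R) (i j : ℕ) :
    Sat (sameReg i j) M w ↔ M.val w i = M.val w j := by
  have : Sat (sameReg i j) M w ↔ ∀ n, (M.Exceeds w i n ↔ M.Exceeds w j n) := by
    simp [sameReg, sat_scan, Exceeds]
  simp only [this, exceeds_iff hM]
  exact ⟨fun h => by have h₁ := h (M.val w i); have h₂ := h (M.val w j); omega,
    fun h n => by rw [h]⟩

theorem sat_diaReg_top (hM : PathFinite M.R) (i : ℕ) :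
    Sat (diaReg i top) M w ↔ 0 < M.val w i := by
  rw [← exceeds_iff hM]
  simp [Exceeds, HasPath]

theorem sat_succReg (hM : PathFinite M.R) (i j : ℕ) :
    Sat (succReg i j) M w ↔ M.val w i = M.val w j + 1 := by
  have : Sat (succReg i j) M w ↔
      0 < M.val w i ∧ ∀ n, (M.Exceeds w i (n + 1) ↔ M.Exceeds w j n) := by
    rw [← sat_diaReg_top M w hM]
    simp [succReg, sat_scan, Exceeds, HasPath]
  simp only [this, exceeds_iff hM]
  refine ⟨fun h => ?_, fun h => ⟨by omega, fun n => by omega⟩⟩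
  -- The scan alone would allow both values to be zero; the first conjunct excludes this.
  have h₁ := h.2 (M.val w i - 1)
  have h₂ := h.2 (M.val w j)
  omega

theorem sat_linkReg (c i k : ℕ) :
    Sat (linkReg c i k) M w ↔
      ∀ n, (M.Exceeds w i n → ∀ u, M.R w u → u ∈ M.V (lnk c) → M.Exceeds u k n) ∧
        ((∃ u, M.R w u ∧ u ∈ M.V (lnk c) ∧ M.Exceeds u k n) → M.Exceeds w i n) := by
  simp [linkReg, sat_scan, Exceeds]

/-- One conjunct bounds the registers of all linked successors from below, the other from above, so
the one satisfying `φ` exceeds exactly the same numbers. Uniqueness of the linked successor is not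
needed in this direction. -/
theorem exists_of_sat_link {c : ℕ} {s : ℕ → ℕ} {K : ℕ} {φ : Formula}
    (h : Sat (link c s K φ) M w) :
    ∃ u, M.R w u ∧ Sat φ M u ∧ ∀ k < K, M.val u k = M.val w (s k) := by
  simp only [link, sat_and, sat_dia, sat_var, sat_conj, List.mem_map, List.mem_range] at h
  obtain ⟨⟨u, hu, hc, hφ⟩, h⟩ := h
  refine ⟨u, hu, hφ, fun k hk => ?_⟩
  have := (sat_linkReg M w c (s k) k).1 (h _ ⟨k, hk, rfl⟩)
  unfold val
  congr 1
  ext n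
  exact ⟨fun hn => (this n).2 ⟨u, hu, hc, hn⟩, fun hn => (this n).1 hn u hu hc⟩

theorem sat_link (hM : PathFinite M.R) {c : ℕ} {s : ℕ → ℕ} {K : ℕ} {φ : Formula} {u : W}
    (hu : M.R w u) (hc : u ∈ M.V (lnk c)) (huniq : ∀ v, M.R w v → v ∈ M.V (lnk c) → v = u)
    (hφ : Sat φ M u) (hval : ∀ k < K, M.val u k = M.val w (s k)) : Sat (link c s K φ) M w := by
  simp only [link, sat_and, sat_dia, sat_var, sat_conj, List.mem_map, List.mem_range]
  refine ⟨⟨u, hu, hc, hφ⟩, ?_⟩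
  rintro _ ⟨k, hk, rfl⟩
  rw [sat_linkReg]
  intro n
  simp only [exceeds_iff hM]
  constructor
  · intro hn v hv hvc
    rw [huniq v hv hvc, hval k hk]
    exact hn
  · rintro ⟨v, hv, hvc, hn⟩
    rwa [huniq v hv hvc, hval k hk] at hn

end Sat

end MISL

namespace MISL

open Formula Model

/-! ### Trees with prescribed register values -/

/-- Finite trees with states labelled by letters. -/
inductive RTree : Type
  | node (a : ℕ) (ts : List RTree) : RTree

namespace RTree

/-- The letter at the root. -/
def label : RTree → ℕ
  | node a _ => a

/-- The immediate subtrees. -/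
def children : RTree → List RTree
  | node _ ts => ts

/-- The model whose states are all finite labelled trees; exactly one letter, the label of its
root, is true at a tree. -/
def univModel : Model RTree where
  R t s := s ∈ t.children
  V p := {t | t.label = p}

theorem wellFounded_univModel : WellFounded (flip univModel.R) := by
  refine Subrelation.wf (r := InvImage (· < ·) (sizeOf : RTree → ℕ)) ?_ (InvImage.wf _ wellFounded_lt)
  rintro s ⟨a, ts⟩ (h : s ∈ ts)
  have := List.sizeOf_lt_of_mem h
  simp only [InvImage, node.sizeOf_spec]
  omega

theorem finite_univModel (t : RTree) : {s | univModel.R t s}.Finite := t.children.finite_toSet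

theorem pathFinite_univModel : PathFinite univModel.R :=
  .of_wellFounded wellFounded_univModel finite_univModel

theorem pathFinite_univModel_assign (S : Set RTree) : PathFinite (univModel.assign 0 S).R :=
  pathFinite_univModel

/-- A path with `k + 1` states, the first one labelled by `a`. -/
def chain (a : ℕ) : ℕ → RTree
  | 0 => node a []
  | k + 1 => node a [chain 0 k]

@[simp] theorem label_chain (a k : ℕ) : (chain a k).label = a := by
  cases k <;> rfl

theorem hasPath_chain (n a k : ℕ) : HasPath univModel.R n (chain a k) ↔ n ≤ k := by
  induction n generalizing a k with
  | zero => simp [HasPath]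
  | succ n ih => 
    rcases k with _ | k
    · simp [HasPath, chain, univModel, children]
    · simpa [HasPath, chain, univModel, children] using ih 0 k

/-- The immediate subtrees needed to give register `i` the value `n`. -/
def numeral (i : ℕ) : ℕ → List RTree
  | 0 => []
  | n + 1 => [chain (reg i) n]

/-- The tree with the values `ρ i` in the registers `i < K` and with further subtrees `ls`. -/
def build (K : ℕ) (ρ : ℕ → ℕ) (ls : List RTree) : List RTree :=
  ((List.range K).flatMap fun i => numeral i (ρ i)) ++ ls

theorem label_of_mem_numeral {i n : ℕ} {t : RTree} (h : t ∈ numeral i n) : t.label = reg i := by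
  cases n <;> simp_all [numeral]

/-- Register and link letters are disjoint, so the subtrees in `ls` contribute to no register, and
register `i` is determined by its own chain. -/
theorem val_build (a : ℕ) {K : ℕ} {ρ : ℕ → ℕ} {ls : List RTree}
    (hls : ∀ t ∈ ls, ∃ j, t.label = lnk j) {i : ℕ} (hi : i < K) :
    univModel.val (node a (build K ρ ls)) i = ρ i := by
  refine val_eq_of_forall pathFinite_univModel fun n => ?_
  constructor
  · rintro ⟨t, ht, hl, hp⟩
    change t ∈ build K ρ ls at ht
    change t.label = reg i at hl
    simp only [build, List.mem_append, List.mem_flatMap, List.mem_range] at ht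
    obtain ⟨j, -, hj⟩ | ht := ht
    · have := label_of_mem_numeral hj
      obtain rfl : j = i := by simp only [hl, reg] at this; omega
      cases hρ : ρ j with
      | zero => simp [hρ, numeral] at hj
      | succ m =>
        simp only [hρ, numeral, List.mem_singleton] at hj
        subst hj
        rw [hasPath_chain] at hp
        omega
    · obtain ⟨j, hj⟩ := hls t ht
      simp only [hl, reg, lnk] at hj
      omega
  · intro hn
    refine ⟨chain (reg i) (ρ i - 1), ?_, label_chain _ _, (hasPath_chain _ _ _).2 (by omega)⟩
    change _ ∈ build K ρ ls
    simp only [build, List.mem_append, List.mem_flatMap, List.mem_range]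
    refine Or.inl ⟨i, hi, ?_⟩
    obtain ⟨m, hm⟩ : ∃ m, ρ i = m + 1 := ⟨ρ i - 1, by omega⟩
    simp [hm, numeral]

theorem sat_link_build (a : ℕ) {K : ℕ} {ρ : ℕ → ℕ} {ls : List RTree}
    (hls : ∀ t ∈ ls, ∃ j, t.label = lnk j) {S : Set RTree} {c : ℕ} {s : ℕ → ℕ} {L : ℕ}
    {φ : Formula} {u : RTree} (hu : u ∈ ls) (hc : u.label = lnk c)
    (huniq : ∀ t ∈ ls, t.label = lnk c → t = u) (hφ : Sat φ (univModel.assign 0 S) u)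
    (hs : ∀ k < L, s k < K) (hval : ∀ k < L, univModel.val u k = ρ (s k)) :
    Sat (link c s L φ) (univModel.assign 0 S) (node a (build K ρ ls)) := by
  refine sat_link _ _ (pathFinite_univModel_assign S) (u := u) ?_ ?_ ?_ hφ ?_
  · exact List.mem_append_right _ hu
  · rw [assign_V_lnk]; exact hc
  · intro t ht htc
    rw [assign_V_lnk] at htc
    change t.label = lnk c at htc
    change t ∈ build K ρ ls at ht
    simp only [build, List.mem_append, List.mem_flatMap] at ht
    obtain ⟨j, -, hj⟩ | ht := ht
    · have := label_of_mem_numeral hj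
      simp only [htc, reg, lnk] at this
      omega
    · exact huniq t ht htc
  · intro k hk
    rw [val_assign, val_assign, val_build a hls (hs k hk), hval k hk]

end RTree

/-! ### Formulas for primitive recursive functions -/

open RTree

/-- The entries of a vector, followed by zeros. -/
def entry {n : ℕ} (v : List.Vector ℕ n) (k : ℕ) : ℕ := v.toList.getD k 0

@[simp] theorem entry_cons_zero {n : ℕ} (x : ℕ) (v : List.Vector ℕ n) : entry (x ::ᵥ v) 0 = x := by
  simp [entry]

@[simp] theorem entry_cons_succ {n : ℕ} (x : ℕ) (v : List.Vector ℕ n) (k : ℕ) :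
    entry (x ::ᵥ v) (k + 1) = entry v k := by
  simp [entry]

theorem entry_eq_get {n : ℕ} (v : List.Vector ℕ n) (i : Fin n) : entry v i = v.get i := by
  simp [entry, List.Vector.get_eq_get_toList]

theorem entry_ofFn {n : ℕ} (f : Fin n → ℕ) {k : ℕ} (hk : k < n) :
    entry (List.Vector.ofFn f) k = f ⟨k, hk⟩ := by
  rw [← List.Vector.get_ofFn f ⟨k, hk⟩, ← entry_eq_get]

/-- The entries of `v` followed by `y`. -/
def graphEntry {n : ℕ} (v : List.Vector ℕ n) (y k : ℕ) : ℕ := if k < n then entry v k else y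

/-- `φ` forces register `n` to hold the value of `f` at the registers `k < n`, and all values occur
in finite trees that satisfy `φ`, whatever the truth set of the letter `0`. -/
structure Computes (n : ℕ) (φ : Formula) (f : List.Vector ℕ n → ℕ) : Prop where
  sound : ∀ {W : Type} (M : Model W) (w : W), PathFinite M.R → Sat φ M w →
    ∀ v : List.Vector ℕ n, (∀ k < n, M.val w k = entry v k) → M.val w n = f v
  complete : ∀ v : List.Vector ℕ n, ∃ ts : List RTree, ∀ a,
    (∀ k < n + 1, univModel.val (node a ts) k = graphEntry v (f v) k) ∧
      ∀ S, Sat φ (univModel.assign 0 S) (node a ts)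

theorem computes_zero : Computes 0 (neg (diaReg 0 top)) fun _ => 0 where
  sound M w hM h v _ := by
    rw [sat_neg, sat_diaReg_top M w hM] at h
    omega
  complete v := by
    refine ⟨build 1 (fun _ => 0) [], fun a => ⟨fun k hk => ?_, fun S => ?_⟩⟩
    · rw [val_build a (by simp) hk]
      simp [graphEntry]
    · rw [sat_neg, sat_diaReg_top _ _ (pathFinite_univModel_assign _), val_assign, val_build a (by simp) one_pos]
      simp

theorem computes_succ : Computes 1 (succReg 1 0) fun v => v.head.succ where
  sound M w hM h v hv := by
    rw [sat_succReg M w hM, hv 0 one_pos] at h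
    rw [h, ← List.Vector.get_zero, ← entry_eq_get]
    rfl
  complete v := by
    refine ⟨build 2 (graphEntry v v.head.succ) [], fun a => ⟨fun k hk => ?_, fun S => ?_⟩⟩
    · rw [val_build a (by simp) hk]
    · rw [sat_succReg _ _ (pathFinite_univModel_assign _), val_assign, val_assign, val_build a (by simp) one_lt_two,
        val_build a (by simp) two_pos, ← List.Vector.get_zero, ← entry_eq_get]
      simp [graphEntry]

theorem computes_get {n : ℕ} (i : Fin n) : Computes n (sameReg n i) fun v => v.get i where
  sound M w hM h v hv := by
    rw [sat_sameReg M w hM, hv i i.2] at h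
    rw [h, entry_eq_get]
  complete v := by
    have hi := i.2
    refine ⟨build (n + 1) (graphEntry v (v.get i)) [], fun a => ⟨fun k hk => ?_, fun S => ?_⟩⟩
    · rw [val_build a (by simp) hk]
    · rw [sat_sameReg _ _ (pathFinite_univModel_assign _), val_assign, val_assign, val_build a (by simp) (by omega),
        val_build a (by simp) (by omega)]
      simp [graphEntry, entry_eq_get]

/-- The formula for the composition of `f` with `g₀, …, gₙ₋₁`, all of arity `m`. The values of the
`gⱼ` are held in the registers `m + 1 + j`. -/
def compFormula (m n : ℕ) (φ : Formula) (γ : Fin n → Formula) : Formula :=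
  and (conj (List.ofFn fun j : Fin n => link j (fun k => if k < m then k else m + 1 + j) (m + 1) (γ j)))
    (link n (fun k => if k < n then m + 1 + k else m) (n + 1) φ)

/-- Each `gⱼ` is evaluated in its own linked subtree, which receives the arguments and returns its
value to register `m + 1 + j`; one more subtree applies `f` to these registers. A witness for a
subtree may have any root label, so it can be given the required link letter. -/
theorem computes_comp {m n : ℕ} {f : List.Vector ℕ n → ℕ} {g : Fin n → List.Vector ℕ m → ℕ}
    {φ : Formula} {γ : Fin n → Formula} (hf : Computes n φ f) (hg : ∀ j, Computes m (γ j) (g j)) :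
    Computes m (compFormula m n φ γ) fun v => f (List.Vector.ofFn fun j => g j v) where
  sound M w hM h v hv := by
    simp only [compFormula, sat_and, sat_conj, List.mem_ofFn] at h
    obtain ⟨h₁, h₂⟩ := h
    have hγ : ∀ j : Fin n, M.val w (m + 1 + j) = g j v := by
      intro j
      obtain ⟨u, -, hu, hval⟩ := exists_of_sat_link M w (h₁ _ ⟨j, rfl⟩)
      have := (hg j).sound M u hM hu v fun k hk => by
        rw [hval k (by omega), if_pos hk, hv k hk]
      rw [hval m (by omega), if_neg (lt_irrefl _)] at this
      exact this
    obtain ⟨u, -, hu, hval⟩ := exists_of_sat_link M w h₂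
    have := hf.sound M u hM hu (List.Vector.ofFn fun j => g j v) fun k hk => by
      rw [hval k (by omega), if_pos hk, entry_ofFn _ hk]
      exact hγ ⟨k, hk⟩
    rwa [hval n (by omega), if_neg (lt_irrefl _)] at this
  complete v := by
    set z := List.Vector.ofFn fun j => g j v with hz
    choose ts hts using fun j => (hg j).complete v
    obtain ⟨us, hus⟩ := hf.complete z
    set ls : List RTree := List.ofFn (fun j : Fin n => node (lnk j) (ts j)) ++ [node (lnk n) us] with hls
    -- Arguments and result come first, then the intermediate values `g j v`.
    set ρ : ℕ → ℕ := fun k => if k < m + 1 then graphEntry v (f z) k else entry z (k - (m + 1)) with hρ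
    have hmem : ∀ t ∈ ls, (∃ j : Fin n, node (lnk j) (ts j) = t) ∨ t = node (lnk n) us := by
      intro t ht
      simpa [hls] using ht
    have hlab : ∀ t ∈ ls, ∃ j, t.label = lnk j := by
      intro t ht
      obtain ⟨j, rfl⟩ | rfl := hmem t ht
      · exact ⟨j, rfl⟩
      · exact ⟨n, rfl⟩
    have hn : ∀ j : Fin n, (j : ℕ) ≠ n := fun j => j.2.ne
    refine ⟨build (m + 1 + n) ρ ls, fun a => ⟨fun k hk => ?_, fun S => ?_⟩⟩
    · rw [val_build a hlab (by omega)]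
      simp only [hρ, if_pos hk]
    · simp only [compFormula, sat_and, sat_conj, List.mem_ofFn]
      constructor
      · rintro _ ⟨j, rfl⟩
        have hj := j.2
        refine sat_link_build a hlab (u := node (lnk j) (ts j))
          (List.mem_append_left _ (by rw [List.mem_ofFn]; exact ⟨j, rfl⟩)) rfl ?_
          ((hts j _).2 S) (fun k hk => by split_ifs <;> omega) fun k hk => ?_
        · intro t ht hl
          obtain ⟨i, rfl⟩ | rfl := hmem t ht
          · obtain rfl : i = j := Fin.ext (by simpa [label, lnk] using hl)
            rfl
          · exact absurd hl (by simpa [label, lnk] using (hn j).symm)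
        · rw [(hts j _).1 k hk]
          by_cases hkm : k < m
          · simp [hρ, hkm, hkm.le, graphEntry]
          · have : ¬ m + 1 + (j : ℕ) ≤ m := by omega
            simp [hρ, hkm, graphEntry, hz, entry_ofFn _ hj, this]
      · refine sat_link_build a hlab (u := node (lnk n) us) (by simp [hls]) rfl ?_
          ((hus _).2 S) (fun k hk => by split_ifs <;> omega) fun k hk => ?_
        · intro t ht hl
          obtain ⟨i, rfl⟩ | rfl := hmem t ht
          · exact absurd hl (by simpa [label, lnk] using hn i)
          · rfl
        · rw [(hus _).1 k hk]
          by_cases hkn : k < n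
          · have : ¬ m + 1 + k ≤ m := by omega
            simp [hρ, hkn, graphEntry, this]
          · simp [hρ, hkn, graphEntry]

/-- The body of the fixed point formula for primitive recursion with `n` parameters. The registers
hold the recursion variable, the parameters, the value, the predecessor of the recursion variable
and the value at the predecessor. -/
def precBody (n : ℕ) (φ γ : Formula) : Formula :=
  or (and (neg (diaReg 0 top)) (link 0 (fun k => k + 1) (n + 1) φ))
    (and (succReg 0 (n + 2))
      (and (link 1 (fun k => if k = 0 then n + 2 else if k < n + 1 then k else n + 3) (n + 2) (var 0))
        (link 0 (fun k => if k = 0 then n + 2 else if k = 1 then n + 3 else k - 1) (n + 3) γ)))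

/-- Soundness is an induction on the stage at which a state enters the iteration; no monotonicity is
needed. Completeness is an induction on the recursion variable, nesting the tree for `x` inside the
tree for `x + 1` and raising the stage by one. -/
theorem computes_prec {n : ℕ} {f : List.Vector ℕ n → ℕ} {g : List.Vector ℕ (n + 2) → ℕ}
    {φ γ : Formula} (hf : Computes n φ f) (hg : Computes (n + 2) γ g) :
    Computes (n + 1) (lfp (precBody n φ γ)) fun v =>
      v.head.rec (f v.tail) fun y IH => g (y ::ᵥ IH ::ᵥ v.tail) where
  sound M w hM h v hv := by
    rw [sat_lfp] at h
    obtain ⟨N, h⟩ := h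
    induction N generalizing w v with
    | zero => simp at h
    | succ N ih =>
      rw [Function.iterate_succ_apply'] at h
      set X := (fun X : Set _ => {v | Sat (precBody n φ γ) (M.assign 0 X) v})^[N] ∅
      change Sat _ _ _ at h
      obtain ⟨x, v, rfl⟩ := v.exists_eq_cons
      have hx : M.val w 0 = x := by simpa using hv 0 (by omega)
      have hv' : ∀ k < n, M.val w (k + 1) = entry v k := fun k hk => by
        simpa using hv (k + 1) (by omega)
      simp only [List.Vector.head_cons, List.Vector.tail_cons]
      have hMX : PathFinite (M.assign 0 X).R := hM
      simp only [precBody, sat_or, sat_and, sat_neg, sat_diaReg_top _ _ hMX, sat_succReg _ _ hMX,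
        val_assign] at h
      obtain ⟨h₀, h₁⟩ | ⟨h₀, h₁, h₂⟩ := h
      · obtain ⟨u, -, hu, hval⟩ := exists_of_sat_link _ _ h₁
        obtain rfl : x = 0 := by omega
        simp only [val_assign] at hval
        have := hf.sound _ u hMX hu v fun k hk => by
          rw [val_assign, hval k (by omega), hv' k hk]
        rw [val_assign, hval n (by omega)] at this
        exact this
      · obtain ⟨u, -, hu, hval⟩ := exists_of_sat_link _ _ h₁
        obtain ⟨u', -, hu', hval'⟩ := exists_of_sat_link _ _ h₂
        simp only [val_assign] at hval hval'
        obtain ⟨x, rfl⟩ : ∃ y, x = y + 1 := ⟨x - 1, by omega⟩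
        -- The successor `u` belongs to the previous stage, so its value register is correct at `x`;
        -- this value is register `n + 3` of `w`.
        have hu₁ := ih u (x ::ᵥ v) (by
          rintro (_ | k) hk
          · rw [hval 0 (by omega), if_pos rfl, entry_cons_zero]
            omega
          · rw [hval (k + 1) (by omega), if_neg (by omega), if_pos hk, entry_cons_succ,
              hv' k (by omega)]) (by simpa using hu)
        simp only [List.Vector.head_cons, List.Vector.tail_cons] at hu₁
        rw [hval (n + 1) (by omega), if_neg (by omega), if_neg (by omega)] at hu₁
        have := hg.sound _ u' hMX hu' (x ::ᵥ M.val w (n + 3) ::ᵥ v) (by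
          rintro (_ | _ | k) hk
          · rw [val_assign, hval' 0 (by omega), if_pos rfl, entry_cons_zero]
            omega
          · rw [val_assign, hval' 1 (by omega), if_neg (by omega), if_pos rfl, entry_cons_succ,
              entry_cons_zero]
          · rw [val_assign, hval' (k + 2) (by omega), if_neg (by omega), if_neg (by omega),
              entry_cons_succ, entry_cons_succ, ← hv' k (by omega)]
            rfl)
        rw [val_assign, hval' (n + 2) (by omega), if_neg (by omega), if_neg (by omega), hu₁] at this
        exact this
  complete v := by
    obtain ⟨x, v, rfl⟩ := v.exists_eq_cons
    simp only [List.Vector.head_cons, List.Vector.tail_cons]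
    set F : ℕ → ℕ := fun x => Nat.rec (f v) (fun y IH => g (y ::ᵥ IH ::ᵥ v)) x with hF
    change ∃ ts, ∀ a, (∀ k < n + 1 + 1, _ = graphEntry (x ::ᵥ v) (F x) k) ∧ _
    -- The fixed point formula resets the letter `0`, so the given set `S` disappears.
    simp only [sat_lfp, assign_assign]
    have hsucc : ∀ x, F (x + 1) = g (x ::ᵥ F x ::ᵥ v) := fun x => rfl
    have hzero : F 0 = f v := rfl
    -- From here on only the two recursion equations are used.
    clear_value F
    suffices ∃ ts, ∀ a, (∀ k < n + 1 + 1, univModel.val (node a ts) k = graphEntry (x ::ᵥ v) (F x) k) ∧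
        ∃ N, node a ts ∈
          (fun X : Set _ => {v | Sat (precBody n φ γ) (univModel.assign 0 X) v})^[N] ∅ by
      obtain ⟨ts, h⟩ := this
      exact ⟨ts, fun a => ⟨(h a).1, fun _ => (h a).2⟩⟩
    induction x with
    | zero =>
      obtain ⟨ts, hts⟩ := hf.complete v
      have hlab : ∀ t ∈ [node (lnk 0) ts], ∃ j, t.label = lnk j := by
        intro t ht
        rw [List.mem_singleton] at ht
        exact ⟨0, ht ▸ rfl⟩
      refine ⟨build (n + 2) (graphEntry (0 ::ᵥ v) (F 0)) [node (lnk 0) ts],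
        fun a => ⟨fun k hk => val_build a hlab hk, 1, ?_⟩⟩
      simp only [Function.iterate_one, Set.mem_ofPred_eq, precBody, sat_or, sat_and, sat_neg]
      refine Or.inl ⟨?_, ?_⟩
      · rw [sat_diaReg_top _ _ (pathFinite_univModel_assign _), val_assign, val_build a hlab (by omega)]
        simp [graphEntry]
      · refine sat_link_build a hlab (u := node (lnk 0) ts) (by simp) rfl (by simp)
          ((hts _).2 _) (fun k hk => by omega) fun k hk => ?_
        rw [(hts _).1 k hk]
        simp [graphEntry, hzero]
    | succ x ih =>
      obtain ⟨ts, hts⟩ := ih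
      obtain ⟨us, hus⟩ := hg.complete (x ::ᵥ F x ::ᵥ v)
      -- The tree for `x` gets the root label under which the body looks for the recursive call.
      obtain ⟨hval, N, hN⟩ := hts (lnk 1)
      set ls := [node (lnk 0) us, node (lnk 1) ts] with hls
      have hlab : ∀ t ∈ ls, ∃ j, t.label = lnk j := by
        intro t ht
        simp only [hls, List.mem_cons, List.not_mem_nil, or_false] at ht
        obtain rfl | rfl := ht
        · exact ⟨0, rfl⟩
        · exact ⟨1, rfl⟩
      set ρ : ℕ → ℕ := fun k => if k < n + 2 then graphEntry ((x + 1) ::ᵥ v) (F (x + 1)) k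
        else if k = n + 2 then x else F x with hρ
      refine ⟨build (n + 4) ρ ls, fun a => ⟨fun k hk => ?_, N + 1, ?_⟩⟩
      · rw [val_build a hlab (by omega)]
        simp only [hρ]
        rw [if_pos hk]
      · rw [Function.iterate_succ_apply']
        set X := (fun X : Set _ => {v | Sat (precBody n φ γ) (univModel.assign 0 X) v})^[N] ∅
        simp only [Set.mem_ofPred_eq, precBody, sat_or, sat_and, sat_neg]
        refine Or.inr ⟨?_, ?_, ?_⟩
        · rw [sat_succReg _ _ (pathFinite_univModel_assign _), val_assign, val_assign, val_build a hlab (by omega),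
            val_build a hlab (by omega)]
          simp [hρ, graphEntry]
        · refine sat_link_build a hlab (u := node (lnk 1) ts) (by simp [hls]) rfl ?_
            (by simpa using hN) (fun k hk => by split_ifs <;> omega) fun k hk => ?_
          · intro t ht hl
            simp only [hls, List.mem_cons, List.not_mem_nil, or_false] at ht
            obtain rfl | rfl := ht
            · simp [label, lnk] at hl
            · rfl
          · rw [hval k hk]
            rcases k with _ | k
            · simp [hρ, graphEntry]
            · by_cases hk' : k < n
              · simp [hρ, graphEntry, hk', hk]
              · simp [hρ, graphEntry, hk']
        · refine sat_link_build a hlab (u := node (lnk 0) us) (by simp [hls]) rfl ?_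
            ((hus _).2 _) (fun k hk => by split_ifs <;> omega) fun k hk => ?_
          · intro t ht hl
            simp only [hls, List.mem_cons, List.not_mem_nil, or_false] at ht
            obtain rfl | rfl := ht
            · rfl
            · simp [label, lnk] at hl
          · rw [(hus _).1 k hk]
            rcases k with _ | _ | k
            · simp [hρ, graphEntry]
            · simp [hρ, graphEntry]
            · by_cases hk' : k < n
              · simp [hρ, graphEntry, hk', show k < n + 1 by omega]
              · obtain rfl : k = n := by omega
                simp [hρ, graphEntry, hsucc]

theorem exists_computes {n : ℕ} {f : List.Vector ℕ n → ℕ} (hf : Nat.Primrec' f) :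
    ∃ φ, Computes n φ f := by
  induction hf with
  | zero => exact ⟨_, computes_zero⟩
  | succ => exact ⟨_, computes_succ⟩
  | get i => exact ⟨_, computes_get i⟩
  | comp g _ _ hf hg =>
    obtain ⟨φ, hφ⟩ := hf
    choose γ hγ using hg
    exact ⟨_, computes_comp hφ hγ⟩
  | prec _ _ hf hg =>
    obtain ⟨φ, hφ⟩ := hf
    obtain ⟨γ, hγ⟩ := hg
    exact ⟨_, computes_prec hφ hγ⟩

end MISL

namespace MISL

open Formula Model

/-! ### Bounded morphisms and unravelling -/

namespace Model

/-- The model with relation `R` whose valuation is pulled back along `f`. -/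
def pullback {W W' : Type} (R : W → W → Prop) (f : W → W') (N : Model W') : Model W where
  R := R
  V p := f ⁻¹' N.V p

theorem pullback_assign {W W' : Type} (R : W → W → Prop) (f : W → W') (N : Model W') (p : ℕ)
    (S : Set W') : (pullback R f N).assign p (f ⁻¹' S) = pullback R f (N.assign p S) := by
  simp only [pullback, assign, Model.mk.injEq, true_and]
  funext q
  by_cases h : q = p
  · subst h; simp
  · simp [h]

/-- Truth is invariant under bounded morphisms. -/
theorem sat_pullback {W W' : Type} {R : W → W → Prop} {R' : W' → W' → Prop} {f : W → W'}
    (hforth : ∀ w v, R w v → R' (f w) (f v)) (hback : ∀ w v', R' (f w) v' → ∃ v, R w v ∧ f v = v')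
    (φ : Formula) (N : Model W') (hN : N.R = R') (w : W) :
    Sat φ (pullback R f N) w ↔ Sat φ N (f w) := by
  induction φ generalizing N w with
  | var p => rfl
  | neg φ ih => exact not_congr (ih N hN w)
  | and φ ψ ihφ ihψ => exact and_congr (ihφ N hN w) (ihψ N hN w)
  | dia φ ih =>
    constructor
    · rintro ⟨v, hv, h⟩
      exact ⟨f v, hN ▸ hforth w v hv, (ih N hN v).1 h⟩
    · rintro ⟨v', hv', h⟩
      obtain ⟨v, hv, rfl⟩ := hback w v' (hN ▸ hv')
      exact ⟨v, hv, (ih N hN v).2 h⟩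
  | sub p ψ φ ihψ ihφ =>
    have : {v | Sat ψ (pullback R f N) v} = f ⁻¹' {v | Sat ψ N v} := Set.ext fun v => ihψ N hN v
    simp only [Sat]
    rw [this, pullback_assign]
    exact ihφ (N.assign p {v | Sat ψ N v}) hN w
  | iter p ψ φ ihψ ihφ =>
    -- The substituted truth set is itself a preimage by `ihψ`, so every iterate remains a pullback.
    have key : ∀ n, ((fun N : Model W' => N.assign p {v | Sat ψ N v})^[n] N).R = R' ∧
        (fun N : Model W => N.assign p {v | Sat ψ N v})^[n] (pullback R f N) =
          pullback R f ((fun N : Model W' => N.assign p {v | Sat ψ N v})^[n] N) := by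
      intro n
      induction n with
      | zero => exact ⟨hN, rfl⟩
      | succ n ih =>
        rw [Function.iterate_succ_apply', Function.iterate_succ_apply', ih.2]
        refine ⟨ih.1, ?_⟩
        rw [← pullback_assign]
        congr 1
        exact Set.ext fun v => ihψ _ ih.1 v
    simp only [Sat]
    refine exists_congr fun n => ?_
    rw [(key n).2]
    exact ihφ _ (key n).1 w

end Model

/-- In a finite tree model, the paths from each state have bounded length. -/
theorem Model.IsFiniteTree.pathFinite {W : Type} {M : Model W} (h : M.IsFiniteTree) :
    PathFinite M.R := by
  obtain ⟨hfin, -, hacyc⟩ := h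
  have : Std.Irrefl (flip (Relation.TransGen M.R)) := ⟨hacyc⟩
  have : IsTrans W (flip (Relation.TransGen M.R)) := ⟨fun a b c hab hbc => hbc.trans hab⟩
  have hwf := Finite.wellFounded_of_trans_of_irrefl (flip (Relation.TransGen M.R))
  exact .of_wellFounded (Subrelation.wf (fun h => .single h) hwf) fun w => Set.toFinite _

section Unravel

variable {W : Type} (N : Model W) (w : W)

/-- The paths from `w`, without their first state. -/
def Path : Type := {l : List W // (w :: l).IsChain N.R}

/-- The last state of a path. -/
def Path.target (l : Path N w) : W := (w :: l.1).getLast (List.cons_ne_nil _ _)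

/-- Extension of a path by one state. -/
def Path.Ext (l l' : Path N w) : Prop := ∃ s, l'.1 = l.1 ++ [s]

variable {N w}

theorem isChain_append_singleton_iff {l : List W} {s : W} :
    (w :: (l ++ [s])).IsChain N.R ↔
      (w :: l).IsChain N.R ∧ N.R ((w :: l).getLast (List.cons_ne_nil _ _)) s := by
  rw [← List.cons_append, List.isChain_append]
  simp [List.getLast?_eq_getLast_of_ne_nil]

theorem finite_path (hwf : WellFounded (flip N.R)) (hfin : ∀ w, {v | N.R w v}.Finite) :
    Finite (Path N w) := by
  change {l : List W | (w :: l).IsChain N.R}.Finite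
  induction w using hwf.induction with
  | _ w ih =>
    refine (((hfin w).biUnion fun v hv => (ih v hv).image (List.cons v)).insert []).subset ?_
    rintro (_ | ⟨v, l⟩) hl
    · simp
    · have hl : (w :: v :: l).IsChain N.R := hl
      rw [List.isChain_cons_cons] at hl
      exact Or.inr (Set.mem_biUnion hl.1 ⟨l, hl.2, rfl⟩)

/-- The root is the empty path, the only predecessor of a path drops its last state, and growing
length excludes cycles. -/
theorem isFiniteTree_path (hwf : WellFounded (flip N.R)) (hfin : ∀ w, {v | N.R w v}.Finite) :
    (pullback (Path.Ext N w) (Path.target N w) N).IsFiniteTree := by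
  refine ⟨finite_path hwf hfin, ⟨⟨[], by simp⟩, ?_, ?_⟩, ?_⟩
  · rintro ⟨l, hl⟩
    induction l using List.reverseRecOn with
    | nil => exact .refl
    | append_singleton l s ih =>
      exact (ih (isChain_append_singleton_iff.1 hl).1).tail ⟨s, rfl⟩
  · rintro ⟨l, hl⟩ hne
    induction l using List.reverseRecOn with
    | nil => exact absurd rfl hne
    | append_singleton l s _ =>
      refine ⟨⟨l, (isChain_append_singleton_iff.1 hl).1⟩, ⟨s, rfl⟩, ?_⟩
      rintro ⟨l', hl'⟩ ⟨s', hs'⟩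
      exact Subtype.ext (List.append_inj_left' hs' rfl).symm
  · have hlen : ∀ l l', Relation.TransGen (Path.Ext N w) l l' → l.1.length < l'.1.length := by
      intro l l' h
      induction h with
      | single h => obtain ⟨s, hs⟩ := h; simp [hs]
      | tail _ h ih => obtain ⟨s, hs⟩ := h; simp [hs]; omega
    exact fun l h => lt_irrefl _ (hlen l l h)

/-- Unravelling: a state of a conversely well-founded, finitely branching model can be replaced by
the root of a finite tree model. -/
theorem finiteTreeSatisfiable_of_sat (hwf : WellFounded (flip N.R))
    (hfin : ∀ w, {v | N.R w v}.Finite) {φ : Formula} (h : Sat φ N w) : FiniteTreeSatisfiable φ := by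
  refine ⟨Path N w, pullback (Path.Ext N w) (Path.target N w) N, ⟨[], by simp⟩,
    isFiniteTree_path hwf hfin, ?_⟩
  refine (sat_pullback (R' := N.R) ?_ ?_ φ N rfl _).2 h
  · rintro ⟨l, hl⟩ ⟨_, hl'⟩ ⟨s, rfl⟩
    have := (isChain_append_singleton_iff.1 hl').2
    simpa [Path.target] using this
  · rintro ⟨l, hl⟩ v hv
    exact ⟨⟨l ++ [v], isChain_append_singleton_iff.2 ⟨hl, hv⟩⟩, ⟨v, rfl⟩, by simp [Path.target]⟩

end Unravel

/-! ### Reduction of recursively enumerable sets -/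

namespace Formula

/-- There is a path of length `n`. -/
def tower (n : ℕ) : Formula := Nat.rec top (fun _ φ => dia φ) n

/-- For a formula `φ` computing a binary function `f`: the value of `f` at some number and `m + 1`
is zero. -/
def haltFormula (φ : Formula) (m : ℕ) : Formula :=
  and φ (and (neg (diaReg 2 top)) (and (diaReg 1 (tower m)) (neg (diaReg 1 (tower (m + 1))))))

theorem primrec_neg : Primrec neg :=
  Primrec.encode_iff.1 ((Primrec.nat_add.comp
    (Primrec.nat_mul.comp (Primrec.const 6) Primrec.encode) (Primrec.const 1)).of_eq fun _ => rfl)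

theorem primrec_dia : Primrec dia :=
  Primrec.encode_iff.1 ((Primrec.nat_add.comp
    (Primrec.nat_mul.comp (Primrec.const 6) Primrec.encode) (Primrec.const 3)).of_eq fun _ => rfl)

theorem primrec_and : Primrec₂ and :=
  Primrec.encode_iff.1 ((Primrec.nat_add.comp (Primrec.nat_mul.comp (Primrec.const 6)
    (Primrec₂.natPair.comp (Primrec.encode.comp Primrec.fst) (Primrec.encode.comp Primrec.snd)))
      (Primrec.const 2)).of_eq fun _ => rfl)

theorem primrec_tower : Primrec tower :=
  Primrec.nat_rec₁ top (primrec_dia.comp Primrec.snd)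

/-- `φ` is fixed and only the towers vary with `m`, so primitive recursiveness of `neg`, `and` and
`dia` suffices. -/
theorem primrec_haltFormula (φ : Formula) : Primrec (haltFormula φ) := by
  have h : Primrec fun m => diaReg 1 (tower m) :=
    primrec_dia.comp (primrec_and.comp (Primrec.const _) primrec_tower)
  exact primrec_and.comp (Primrec.const _) (primrec_and.comp (Primrec.const _)
    (primrec_and.comp h (primrec_neg.comp (h.comp Primrec.succ))))

end Formula

theorem sat_tower {W : Type} (M : Model W) (w : W) (n : ℕ) :
    Sat (tower n) M w ↔ HasPath M.R n w := by
  induction n generalizing w with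
  | zero => simp [tower, HasPath]
  | succ n ih => exact exists_congr fun v => and_congr_right fun _ => ih v

theorem sat_diaReg_tower {W : Type} {M : Model W} (hM : PathFinite M.R) (w : W) (i n : ℕ) :
    Sat (diaReg i (tower n)) M w ↔ n < M.val w i := by
  rw [← exceeds_iff hM]
  simp [Exceeds, sat_tower]

theorem sat_haltFormula {W : Type} {M : Model W} (hM : PathFinite M.R) (w : W) (φ : Formula)
    (m : ℕ) : Sat (haltFormula φ m) M w ↔ Sat φ M w ∧ M.val w 2 = 0 ∧ M.val w 1 = m + 1 := by
  rw [haltFormula, sat_and, sat_and, sat_and, sat_neg, sat_neg, sat_diaReg_top _ _ hM,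
    sat_diaReg_tower hM, sat_diaReg_tower hM]
  exact and_congr_right fun _ => by omega

/-- The formula fixes registers 1 and 2 but leaves register 0 free; its value is the existentially
quantified `k`. -/
theorem finiteTreeSatisfiable_haltFormula {φ : Formula} {f : List.Vector ℕ 2 → ℕ}
    (hφ : Computes 2 φ f) (m : ℕ) :
    FiniteTreeSatisfiable (haltFormula φ m) ↔ ∃ k, f (k ::ᵥ (m + 1) ::ᵥ .nil) = 0 := by
  constructor
  · rintro ⟨W, M, w, hM, h⟩
    obtain ⟨h, h₂, h₁⟩ := (sat_haltFormula hM.pathFinite w φ m).1 h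
    refine ⟨M.val w 0, ?_⟩
    rw [← hφ.sound M w hM.pathFinite h, h₂]
    rintro (_ | _ | k) hk
    · simp
    · simpa using h₁
    · omega
  · rintro ⟨k, hk⟩
    obtain ⟨ts, hts⟩ := hφ.complete (k ::ᵥ (m + 1) ::ᵥ .nil)
    obtain ⟨hval, h⟩ := hts 0
    refine finiteTreeSatisfiable_of_sat (N := RTree.univModel.assign 0 ∅)
      RTree.wellFounded_univModel RTree.finite_univModel
      ((sat_haltFormula (RTree.pathFinite_univModel_assign ∅) (.node 0 ts) φ m).2 ⟨h ∅, ?_, ?_⟩)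
    · rw [val_assign, hval 2 (by omega), hk]
      simp [graphEntry]
    · rw [val_assign, hval 1 (by omega)]
      simp [graphEntry]

/-- Every recursively enumerable set reduces to satisfiability in finite tree models. -/
theorem exists_computable_finiteTreeSatisfiable_iff {α : Type*} [Primcodable α]
    {Q : α → ℕ → Prop} (hQ : PrimrecRel Q) :
    ∃ φ : α → Formula, Computable φ ∧ ∀ a, FiniteTreeSatisfiable (φ a) ↔ ∃ k, Q a k := by
  classical
  have hq : Primrec₂ fun a k => cond (decide (Q a k)) 0 1 :=
    Primrec.cond hQ.decide (Primrec.const 0) (Primrec.const 1)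
  -- `m.pred` undoes the shift by one in `haltFormula`. The default value 1 makes numbers that code
  -- nothing count as failures.
  have hf : Primrec₂ fun k m : ℕ => ((Encodable.decode (α := α) m.pred).map
      fun a => cond (decide (Q a k)) 0 1).getD 1 :=
    Primrec.option_getD.comp (Primrec.option_map
      (Primrec.decode.comp (Primrec.pred.comp Primrec.snd))
      (hq.comp₂ Primrec₂.right (Primrec.fst.comp₂ Primrec₂.left))) (Primrec.const 1)
  obtain ⟨φ, hφ⟩ := exists_computes (Nat.Primrec'.prim_iff₂.2 hf)
  refine ⟨fun a => haltFormula φ (Encodable.encode a),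
    ((primrec_haltFormula φ).comp Primrec.encode).to_comp, fun a => ?_⟩
  rw [finiteTreeSatisfiable_haltFormula hφ]
  refine exists_congr fun k => ?_
  by_cases h : Q a k <;> simp [h]

/-- Lists of pairs replace lists of indices, whose type depends on `I`, so that candidates have one
coding for all instances. Membership is written as a bounded quantifier to suit the closure
properties of primitive recursive relations. -/
theorem hasPCPSolution_iff (I : List (Word × Word)) :
    HasPCPSolution I ↔ ∃ l : List (Word × Word), l ≠ [] ∧ (∀ x ∈ l, ∃ y ∈ I, y = x) ∧
      l.flatMap Prod.fst = l.flatMap Prod.snd := by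
  constructor
  · rintro ⟨s, hs, h⟩
    refine ⟨s.map I.get, by simpa using hs, ?_, ?_⟩
    · intro x hx
      obtain ⟨i, -, rfl⟩ := List.mem_map.1 hx
      exact ⟨_, List.get_mem I i, rfl⟩
    · simpa [List.flatMap, Function.comp_def] using h
  · rintro ⟨l, hl, hI, h⟩
    obtain ⟨s, rfl⟩ : ∃ s : List (Fin I.length), s.map I.get = l := by
      rw [← Set.mem_range, Set.range_list_map]
      intro x hx
      obtain ⟨y, hy, rfl⟩ := hI x hx
      obtain ⟨i, rfl⟩ := List.get_of_mem hy
      exact ⟨i, rfl⟩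
    refine ⟨s, by simpa using hl, ?_⟩
    simpa [List.flatMap, Function.comp_def] using h

theorem primrecRel_isPCPSolution :
    PrimrecRel fun (I l : List (Word × Word)) => l ≠ [] ∧ (∀ x ∈ l, ∃ y ∈ I, y = x) ∧
      l.flatMap Prod.fst = l.flatMap Prod.snd := by
  refine PrimrecPred.and (PrimrecPred.not (Primrec.eq.comp Primrec.snd (Primrec.const [])))
    (PrimrecPred.and ?_ ?_)
  · have h : PrimrecRel fun (x : Word × Word) (I : List (Word × Word)) => ∃ y ∈ I, y = x :=
      (Primrec.eq (α := Word × Word)).exists_mem_list.comp₂ Primrec₂.right Primrec₂.left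
    exact h.forall_mem_list.comp Primrec.snd Primrec.fst
  · exact Primrec.eq.comp (Primrec.list_flatMap Primrec.snd (Primrec.fst.comp Primrec.snd))
      (Primrec.list_flatMap Primrec.snd (Primrec.snd.comp Primrec.snd))

theorem exists_computable_finiteTreeSatisfiable_iff_hasPCPSolution :
    ∃ φ : List (Word × Word) → Formula, Computable φ ∧
      ∀ I, FiniteTreeSatisfiable (φ I) ↔ HasPCPSolution I := by
  -- A number that codes no list is read as the empty list, which is not a solution.
  obtain ⟨φ, hφ, h⟩ := exists_computable_finiteTreeSatisfiable_iff
    (Q := fun I k => (fun (I l : List (Word × Word)) => l ≠ [] ∧ (∀ x ∈ l, ∃ y ∈ I, y = x) ∧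
      l.flatMap Prod.fst = l.flatMap Prod.snd) I ((Encodable.decode k).getD []))
    (primrecRel_isPCPSolution.comp Primrec.fst
      (Primrec.option_getD.comp (Primrec.decode.comp Primrec.snd) (Primrec.const [])))
  refine ⟨φ, hφ, fun I => ?_⟩
  rw [h, hasPCPSolution_iff]
  constructor
  · rintro ⟨k, hk⟩
    exact ⟨_, hk⟩
  · rintro ⟨l, hl⟩
    exact ⟨Encodable.encode l, by simpa using hl⟩

/-- The reduction is from halting on input 0: a program halts iff `evaln` succeeds for some bound
`k`, and this is primitive recursive in the program and `k`. -/
theorem not_computablePred_finiteTreeSatisfiable : ¬ ComputablePred FiniteTreeSatisfiable := by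
  intro hdec
  obtain ⟨φ, hφ, h⟩ := exists_computable_finiteTreeSatisfiable_iff
    (Q := fun (c : Nat.Partrec.Code) k => Nat.Partrec.Code.evaln k c 0 ≠ none)
    (PrimrecPred.not (Primrec.eq.comp (Nat.Partrec.Code.primrec_evaln.comp
      ((Primrec.snd.pair Primrec.fst).pair (Primrec.const 0))) (Primrec.const none)))
  refine ComputablePred.halting_problem 0 ((ComputablePred.computable_of_manyOneReducible
    (ManyOneReducible.mk FiniteTreeSatisfiable hφ) hdec).of_eq fun c => ?_)
  rw [h, Part.dom_iff_mem]
  simp only [Nat.Partrec.Code.evaln_complete, Option.ne_none_iff_exists', Option.mem_def]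
  exact exists_comm

end MISL

theorem mainTheorem6 :
    (∃ φ : List (MISL.Word × MISL.Word) → MISL.Formula, Computable φ ∧
      ∀ I : List (MISL.Word × MISL.Word), MISL.IsPCPInstance I →
        (MISL.FiniteTreeSatisfiable (φ I) ↔ MISL.HasPCPSolution I)) ∧
    ¬ ComputablePred MISL.FiniteTreeSatisfiable := by
  obtain ⟨φ, hφ, h⟩ := MISL.exists_computable_finiteTreeSatisfiable_iff_hasPCPSolution
  exact ⟨⟨φ, hφ, fun I _ => h I⟩, MISL.not_computablePred_finiteTreeSatisfiable⟩
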